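/- For a number field $K$ write $\Delta_K$ for its discriminant, and for a prime $\ell$ let $h_\ell(K)$ be the number of ideal classes $c$ in the class group of $K$ with $c^\ell=1$. Let $n\ge 1$ be an integer, let $\ell$ be a prime, let $\varepsilon>0$, and let $\varpi$ be a real number with $\varpi<\dfrac{1}{2\ell(n-1)}$ (when $n=1$ this condition is void). Then there is a constant $C>0$, depending only on $n,\ell,\varepsilon,\varpi$, with the following property. Let $K$ be any number field of degree $n$ over $\mathbb{Q}$, let $M\ge 1$, and suppose that there are $M$ distinct integral ideals $I$ of $K$ whose norm $N(I)$ is square-free, coprime to $\Delta_K$, and satisfies $N(I)\le|\Delta_K|^{\varpi}$. Then \[h_\ell(K)\le C\,|\Delta_K|^{1/2+\varepsilon}M^{-1}.\] -/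

import Mathlib

open NumberField

/-- The `ℓ`-torsion subgroup of the ideal class group of `K`: the classes `c` with `c ^ ℓ = 1`. -/
noncomputable def classGroupTorsion (K : Type*) [Field K] [NumberField K] (ℓ : ℕ) :
    Subgroup (ClassGroup (𝓞 K)) :=
  (powMonoidHom ℓ : ClassGroup (𝓞 K) →* ClassGroup (𝓞 K)).ker

/-- `h_ℓ(K)`, the number of elements of the `ℓ`-torsion subgroup of the class group. -/
noncomputable def hTorsion (K : Type*) [Field K] [NumberField K] (ℓ : ℕ) : ℕ :=
  Nat.card (classGroupTorsion K ℓ)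

/-!
Write `D = |disc K|` and `n = [K : ℚ]`. The product `h_ℓ(K) * M` is bounded by the number of pairs
`(c, I)` with `c` an `ℓ`-torsion class and `I` one of the given ideals, and these pairs are injected
into a set of size `O(D ^ (1 / 2 + ε))`.

Represent `c` by an integral ideal `b` and write `b ^ ℓ = (γ)`. Minkowski's theorem, applied to
`b * I` and the box with sides proportional to `|γ|_w ^ (1 / ℓ)`, yields `α` with `(α) = b * I * J`,
where `J` is integral of norm at most `2 √D`, and where each `|α|_w` lies between `D ^ (-2)` times
the side of the box and that side (`exists_span_singleton_eq_mul_of_pow_eq`). Send `(c, I)` to `J`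
together with the integral parts of the logarithms of these ratios in units of `η log D`; the number
of possible integral parts is bounded in terms of `η` and `n`. Ideals `J` of norm at most `X` number
`O(X ^ s)` for each `s > 1`, uniformly in `K` (`card_le_of_absNorm_le`).

If `(c, I)` and `(c', I')` have the same image, then `β = α ^ ℓ γ' / (α' ^ ℓ γ)` generates
`(I / I') ^ ℓ`, and all its absolute values are `(N I / N I') ^ (ℓ / n)` up to a factor `D ^ (ℓ η)`.
When `I ≠ I'`, some prime `P` divides exactly one of them. As the norms are squarefree and prime to
the discriminant, `P` is unramified of degree one, and it is the only prime above its restriction to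
`ℚ(β)`, so `ℚ(β) = K` (`adjoin_eq_top_of_span_mul_pow_eq`). Comparing the discriminant of
`1, β, …, β ^ (n - 1)` with that of a fractional ideal containing these elements gives
`D ≤ (n!)² H ^ (2 (n - 1))`, where `H` is the height of `β`
(`abs_discr_le_of_adjoin_eq_top`). Here `H ≤ D ^ (ℓ (ϖ + n η))`, so this is impossible for large `D`
and small `η`, because `2 ℓ (n - 1) ϖ < 1`. Hence `I = I'`, and then `c = c'`. For bounded `D` the
number `M` is bounded, and the same injection for a single ideal bounds `h_ℓ(K)`.
-/

/-! ### Quotients of ideals of squarefree norm generate the field -/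

/-- Two distinct primes dividing an ideal of squarefree norm lie over different rational primes. -/
theorem eq_of_dvd_of_squarefree_absNorm {R : Type*} [CommRing R] [IsDedekindDomain R]
    [Module.Free ℤ R] [Module.Finite ℤ R] {I P Q : Ideal R} (hP : Prime P) (hQ : Prime Q)
    (hI : Squarefree (Ideal.absNorm I)) (hPI : P ∣ I) (hQI : Q ∣ I) {p : ℕ} (hp : p.Prime)
    (hpP : p ∣ Ideal.absNorm P) (hpQ : p ∣ Ideal.absNorm Q) : P = Q := by
  by_contra hne
  have hndvd : ¬ P ∣ Q := fun h => hne (associated_iff_eq.mp (hP.associated_of_dvd hQ h))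
  obtain ⟨J, rfl⟩ := hQI
  obtain ⟨J', rfl⟩ := (hP.dvd_or_dvd hPI).resolve_left hndvd
  rw [map_mul, map_mul] at hI
  have h1 : p * p ∣ Ideal.absNorm Q * (Ideal.absNorm P * Ideal.absNorm J') := by
    rw [← mul_assoc]
    exact (mul_dvd_mul hpQ hpP).mul_right _
  exact hp.not_isUnit (hI p h1)

section
variable {F K : Type*} [Field F] [NumberField F] [Field K] [NumberField K] [Algebra F K]

/-- A prime `P` of `K` of prime norm `p ∤ disc K`, the only prime above its restriction to
a subfield `F`, forces `F = K`: in `∑ e f = [K : F]` the single summand is `1`. -/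
theorem finrank_eq_one_of_unique_prime_above {P : Ideal (𝓞 K)} (hP : Prime P) {p : ℕ}
    (hp : p.Prime) (hNP : Ideal.absNorm P = p) (hdisc : ¬ (p : ℤ) ∣ discr K)
    (huniq : ∀ Q : Ideal (𝓞 K), Q.IsPrime → Q.LiesOver (P.under (𝓞 F)) → Q = P) :
    Module.finrank F K = 1 := by
  have hPp : P.IsPrime := Ideal.isPrime_of_prime hP
  have hPmem : ((p : ℤ) : 𝓞 K) ∈ P := by
    have := Ideal.absNorm_mem P
    rw [hNP] at this
    exact_mod_cast this
  have hpZ : Prime (p : ℤ) := Nat.prime_iff_prime_int.mp hp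
  have hlies : P.LiesOver (Ideal.span {(p : ℤ)}) :=
    (Ideal.liesOver_span_iff hPp.ne_top hpZ).mpr hPmem
  have hf : P.inertiaDeg ℤ = 1 := by
    have h := Ideal.pow_inertiaDeg p P
    rw [hNP] at h
    exact Nat.pow_right_injective hp.two_le (by simpa using h)
  have hunr : Algebra.IsUnramifiedAt ℤ P :=
    (not_dvd_discr_iff_forall_mem K (𝓞 K) hpZ).mp hdisc P hPp hPmem
  have he : P.ramificationIdx ℤ = 1 := Ideal.ramificationIdx_eq_one P ℤ
  set q := P.under (𝓞 F) with hq
  have hPq : P.LiesOver q := ⟨rfl⟩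
  have hf' : P.inertiaDeg (𝓞 F) = 1 :=
    Nat.dvd_one.mp (hf ▸ Ideal.inertiaDeg_above_dvd (R := ℤ) q P)
  have he' : P.ramificationIdx (𝓞 F) = 1 :=
    Nat.dvd_one.mp (he ▸ Ideal.ramificationIdx_above_dvd (R := ℤ) q P)
  have : Unique (q.primesOver (𝓞 K)) :=
    { default := ⟨P, hPp, hPq⟩
      uniq := fun Q => Subtype.ext (huniq Q.1 Q.2.1 Q.2.2) }
  have hsum := Ideal.sum_ramification_inertia_eq_finrank q (𝓞 K)
  rw [Fintype.sum_unique] at hsum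
  have h2 : (default : q.primesOver (𝓞 K)).1 = P :=
    huniq _ (default : q.primesOver (𝓞 K)).2.1 (default : q.primesOver (𝓞 K)).2.2
  rw [h2, hf', he', mul_one] at hsum
  exact (IsFractionRing.finrank_eq (𝓞 F) F (𝓞 K) K).trans hsum.symm

/-- If `β ∈ F` generates `(I / I')^ℓ` in `K` and some prime `P` divides `I` but not `I'`, then every
prime of `K` above `P ∩ F` divides `I`. As the norm of `I` is squarefree, `P` is the only such
prime and it has degree one. -/
theorem finrank_eq_one_of_span_mul_pow_eq {ℓ : ℕ} {β : F} {a b : 𝓞 K} (hb : b ≠ 0)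
    (hab : (a : K) = b * algebraMap F K β) (hℓ : ℓ ≠ 0) {I I' P : Ideal (𝓞 K)}
    (heq : Ideal.span {a} * I' ^ ℓ = Ideal.span {b} * I ^ ℓ)
    (hI : Squarefree (Ideal.absNorm I))
    (hdisc : Nat.Coprime (Ideal.absNorm I) (discr K).natAbs)
    (hP : Prime P) (hPI : P ∣ I) (hPI' : ¬ P ∣ I') :
    Module.finrank F K = 1 := by
  have hPp : P.IsPrime := Ideal.isPrime_of_prime hP
  obtain ⟨p, hp, hpP⟩ := Nat.exists_prime_and_dvd (n := Ideal.absNorm P)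
    (by rw [Ne, Ideal.absNorm_eq_one_iff]; exact hPp.ne_top)
  have hpI := hpP.trans (map_dvd Ideal.absNorm hPI)
  have hpZ : Prime (p : ℤ) := Nat.prime_iff_prime_int.mp hp
  have hdvd : ¬ (p : ℤ) ∣ discr K := fun h =>
    hp.one_lt.ne' (Nat.dvd_one.mp (hdisc ▸ Nat.dvd_gcd hpI (Int.natCast_dvd.mp h)))
  -- the rational prime dividing the norm of `P` lies in `P`
  obtain ⟨Q, hQmax, hQp, hQP⟩ := Ideal.exists_isMaximal_dvd_of_dvd_absNorm' hp P hpP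
  obtain rfl : Q = P :=
    ((hPp.isMaximal hP.ne_zero).eq_of_le hQmax.ne_top (Ideal.le_of_dvd hQP)).symm
  have hlies : Q.LiesOver (Ideal.span {(p : ℤ)}) := ⟨hQp.symm⟩
  have hPmem : ((p : ℤ) : 𝓞 K) ∈ Q := (Ideal.liesOver_span_iff hPp.ne_top hpZ).mp hlies
  have hdvdNorm : ∀ Q' : Ideal (𝓞 K), Q'.IsPrime → ((p : ℤ) : 𝓞 K) ∈ Q' →
      p ∣ Ideal.absNorm Q' := by
    intro Q' hQ' hmem
    have : Q'.LiesOver (Ideal.span {(p : ℤ)}) :=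
      (Ideal.liesOver_span_iff hQ'.ne_top hpZ).mpr hmem
    rw [← Ideal.pow_inertiaDeg p Q']
    exact dvd_pow_self _ (Ideal.inertiaDeg_pos Q' ℤ).ne'
  have hNP : Ideal.absNorm Q = p := by
    have h1 := Ideal.pow_inertiaDeg p Q
    have hsq : Squarefree (p ^ Q.inertiaDeg ℤ) :=
      h1 ▸ hI.squarefree_of_dvd (map_dvd Ideal.absNorm hPI)
    have h2 : Q.inertiaDeg ℤ = 1 := by
      by_contra hne
      have h3 : 2 ≤ Q.inertiaDeg ℤ := by
        have := Ideal.inertiaDeg_pos Q ℤ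
        omega
      exact hp.not_isUnit (hsq p (by rw [← pow_two]; exact pow_dvd_pow p h3))
    rw [← h1, h2, pow_one]
  refine finrank_eq_one_of_unique_prime_above (F := F) hP hp hNP hdvd ?_
  set q := Q.under (𝓞 F) with hq
  have hqp : q.IsPrime := inferInstance
  have hpq : ((p : ℤ) : 𝓞 F) ∈ q := by
    rw [hq, Ideal.mem_comap, map_intCast]
    exact hPmem
  have hq0 : q ≠ ⊥ := by
    intro h
    rw [h, Ideal.mem_bot] at hpq
    exact hpZ.ne_zero (by exact_mod_cast hpq)
  -- for `β = x / y` with `x, y` integers of `F`, one has `(x) I' ^ ℓ = (y) I ^ ℓ`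
  have key : ∀ x y : 𝓞 F, β * (y : F) = x →
      Ideal.span {algebraMap (𝓞 F) (𝓞 K) x} * I' ^ ℓ =
        Ideal.span {algebraMap (𝓞 F) (𝓞 K) y} * I ^ ℓ := by
    intro x y hxy
    have h1 : algebraMap (𝓞 F) (𝓞 K) x * b = algebraMap (𝓞 F) (𝓞 K) y * a := by
      apply RingOfIntegers.ext
      change algebraMap F K (x : F) * (b : K) = algebraMap F K (y : F) * (a : K)
      rw [hab, ← hxy, map_mul]
      ring
    have h3 : Ideal.span {b} ≠ ⊥ := by simpa using hb
    apply mul_left_cancel₀ h3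
    rw [mul_left_comm _ _ (I ^ ℓ), ← heq, ← mul_assoc, ← mul_assoc,
      Ideal.span_singleton_mul_span_singleton,
      Ideal.span_singleton_mul_span_singleton, mul_comm b, h1]
  have memQ : ∀ x : 𝓞 F, x ∈ q ↔ Q ∣ Ideal.span {algebraMap (𝓞 F) (𝓞 K) x} := by
    intro x
    rw [Ideal.dvd_span_singleton]
    exact Iff.rfl
  have hnum : ∀ x y : 𝓞 F, β * (y : F) = x → x ∈ q := by
    intro x y hxy
    rw [memQ]
    have h1 : Q ∣ Ideal.span {algebraMap (𝓞 F) (𝓞 K) x} * I' ^ ℓ := by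
      rw [key x y hxy]
      exact (dvd_pow hPI hℓ).mul_left _
    exact (hP.dvd_or_dvd h1).resolve_right fun h => hPI' (hP.dvd_of_dvd_pow h)
  obtain ⟨x, y, hxy, hx, hy⟩ : ∃ x y : 𝓞 F, β * (y : F) = x ∧ x ∈ q ∧ y ∉ q := by
    let v : IsDedekindDomain.HeightOneSpectrum (𝓞 F) := ⟨q, hqp, hq0⟩
    obtain ⟨x, ⟨y, hy⟩, h | h⟩ :=
      IsDedekindDomain.HeightOneSpectrum.exists_primeCompl_mul_eq_or_mul_eq v β
    · exact ⟨x, y, h, hnum x y h, hy⟩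
    · exact (hy (hnum y x h)).elim
  intro Q' hQ' hover
  have memQ' : ∀ z : 𝓞 F, z ∈ q ↔ Q' ∣ Ideal.span {algebraMap (𝓞 F) (𝓞 K) z} := by
    intro z
    rw [Ideal.dvd_span_singleton, hover.over]
    exact Iff.rfl
  have hpQ' : ((p : ℤ) : 𝓞 K) ∈ Q' := by
    have := (memQ' _).mp hpq
    rwa [Ideal.dvd_span_singleton, map_intCast] at this
  have hQ'0 : Prime Q' := by
    refine Ideal.prime_of_isPrime (fun h => ?_) hQ'
    rw [h, Ideal.mem_bot] at hpQ'
    exact hpZ.ne_zero (by exact_mod_cast hpQ')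
  have hQ'I : Q' ∣ I := by
    have h1 : Q' ∣ Ideal.span {algebraMap (𝓞 F) (𝓞 K) y} * I ^ ℓ := by
      rw [← key x y hxy]
      exact ((memQ' x).mp hx).mul_right _
    exact hQ'0.dvd_of_dvd_pow
      ((hQ'0.dvd_or_dvd h1).resolve_left fun h => hy ((memQ' y).mpr h))
  exact eq_of_dvd_of_squarefree_absNorm hQ'0 hP hI hQ'I hPI hp (hdvdNorm Q' hQ' hpQ')
    (hdvdNorm Q hPp hPmem)
end

open IntermediateField in
/-- If `β = a / b` generates the ideal `(I / I')^ℓ` for two distinct ideals of squarefree norm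
coprime to the discriminant, then `β` is a primitive element of `K`. -/
theorem adjoin_eq_top_of_span_mul_pow_eq {K : Type*} [Field K] [NumberField K] {ℓ : ℕ}
    (hℓ : ℓ ≠ 0) {a b : 𝓞 K} (ha : a ≠ 0) (hb : b ≠ 0) {I I' : Ideal (𝓞 K)} (hne : I ≠ I')
    (heq : Ideal.span {a} * I' ^ ℓ = Ideal.span {b} * I ^ ℓ)
    (hI : Squarefree (Ideal.absNorm I))
    (hdisc : Nat.Coprime (Ideal.absNorm I) (discr K).natAbs)
    (hI' : Squarefree (Ideal.absNorm I'))
    (hdisc' : Nat.Coprime (Ideal.absNorm I') (discr K).natAbs) :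
    ℚ⟮((a : K) / b)⟯ = ⊤ := by
  have ha' : (a : K) ≠ 0 := by simpa using ha
  have hb' : (b : K) ≠ 0 := by simpa using hb
  have hsq : ∀ J : Ideal (𝓞 K), Squarefree (Ideal.absNorm J) → Squarefree J := by
    intro J hJ Q hQ
    have h1 := hJ (Ideal.absNorm Q) (by simpa using map_dvd Ideal.absNorm hQ)
    rw [Ideal.isUnit_iff, ← Ideal.absNorm_eq_one_iff]
    simpa using h1
  have hdvd : ∀ J J' : Ideal (𝓞 K), Squarefree (Ideal.absNorm J) →
      (∀ P, Prime P → P ∣ J → P ∣ J') → J ∣ J' := by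
    intro J J' hJ h
    have hJ0 : J ≠ 0 := (hsq J hJ).ne_zero
    rcases eq_or_ne J' 0 with rfl | hJ'0
    · exact dvd_zero _
    refine (UniqueFactorizationMonoid.dvd_iff_normalizedFactors_le_normalizedFactors hJ0 hJ'0).mpr
      ((Multiset.le_iff_subset ((UniqueFactorizationMonoid.squarefree_iff_nodup_normalizedFactors
        hJ0).mp (hsq J hJ))).mpr fun P hP => ?_)
    have hPp := UniqueFactorizationMonoid.prime_of_normalized_factor P hP
    exact (UniqueFactorizationMonoid.mem_normalizedFactors_iff hJ'0).mpr
      ⟨hPp, h P hPp (UniqueFactorizationMonoid.dvd_of_mem_normalizedFactors hP)⟩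
  set β : K := (a : K) / b with hβ
  have hmem : β ∈ ℚ⟮β⟯ := mem_adjoin_simple_self ℚ β
  suffices h : Module.finrank ℚ⟮β⟯ K = 1 from IntermediateField.finrank_eq_one_iff_eq_top.mp h
  have hdisj : (∃ P, Prime P ∧ P ∣ I ∧ ¬ P ∣ I') ∨ (∃ P, Prime P ∧ P ∣ I' ∧ ¬ P ∣ I) := by
    by_contra! hcon
    exact hne (dvd_antisymm (hdvd I I' hI hcon.1) (hdvd I' I hI' hcon.2))
  obtain ⟨P, hP, hPI, hPI'⟩ | ⟨P, hP, hPI, hPI'⟩ := hdisj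
  · refine finrank_eq_one_of_span_mul_pow_eq (β := (⟨β, hmem⟩ : ℚ⟮β⟯)) hb ?_ hℓ heq hI hdisc
      hP hPI hPI'
    change (a : K) = b * β
    rw [hβ]
    field_simp
  · refine finrank_eq_one_of_span_mul_pow_eq (β := (⟨β⁻¹, inv_mem hmem⟩ : ℚ⟮β⟯)) ha ?_ hℓ heq.symm
      hI' hdisc' hP hPI hPI'
    change (b : K) = a * β⁻¹
    rw [hβ]
    field_simp

/-! ### The height of a primitive element bounds the discriminant -/

section
variable {ι V : Type*} [Fintype ι] [DecidableEq ι] [AddCommGroup V] [Module ℚ V]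

/-- A basis contained in the lattice spanned by a basis `b` has nonzero integral determinant with
respect to `b`. -/
theorem one_le_abs_det_of_mem_span (b v : Module.Basis ι ℚ V)
    (h : ∀ i, v i ∈ Submodule.span ℤ (Set.range b)) : 1 ≤ |b.det v| := by
  have h1 : ∀ i j, ∃ m : ℤ, (m : ℚ) = b.repr (v j) i := by
    intro i j
    obtain ⟨m, hm⟩ := (b.mem_span_iff_repr_mem ℤ (v j)).mp (h j) i
    exact ⟨m, by simpa using hm⟩
  choose m hm using h1
  have h2 : b.toMatrix v = (Matrix.of m).map (Int.castRingHom ℚ) := by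
    ext i j
    simp [Module.Basis.toMatrix_apply, hm]
  have h3 : b.det v = ((Matrix.of m).det : ℤ) := by
    rw [Module.Basis.det_apply, h2, ← RingHom.mapMatrix_apply, ← RingHom.map_det]
    simp
  have h4 : b.det v ≠ 0 := (b.isUnit_det v).ne_zero
  rw [h3] at h4 ⊢
  exact_mod_cast Int.one_le_abs (by exact_mod_cast h4)
end

section
variable {K : Type*} [Field K] [NumberField K]

open scoped nonZeroDivisors
open Module

/-- A `ℚ`-basis of `K` contained in a fractional ideal `A` has discriminant at least
`N(A)² |disc K|`. -/
theorem absNorm_sq_mul_abs_discr_le {ι : Type*} [Fintype ι] [DecidableEq ι]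
    (A : (FractionalIdeal (𝓞 K)⁰ K)ˣ) (v : Module.Basis ι ℚ K)
    (hv : ∀ i, v i ∈ (A : FractionalIdeal (𝓞 K)⁰ K)) :
    FractionalIdeal.absNorm (A : FractionalIdeal (𝓞 K)⁰ K) ^ 2 * |(discr K : ℚ)| ≤
      |Algebra.discr ℚ v| := by
  classical
  let e : Free.ChooseBasisIndex ℤ (𝓞 K) ≃ Free.ChooseBasisIndex ℤ A := by
    refine Fintype.equivOfCardEq ?_
    rw [← finrank_eq_card_chooseBasisIndex, ← finrank_eq_card_chooseBasisIndex,
      fractionalIdeal_rank]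
  let b := (basisOfFractionalIdeal K A).reindex e.symm
  let f : ι ≃ Free.ChooseBasisIndex ℤ (𝓞 K) := v.indexEquiv (integralBasis K)
  let v' := v.reindex f
  have h1 : 1 ≤ |b.det v'| := by
    refine one_le_abs_det_of_mem_span b v' fun i => ?_
    have : Set.range b = Set.range (basisOfFractionalIdeal K A) := by simp [b]
    rw [this, mem_span_basisOfFractionalIdeal]
    simpa [v'] using hv (f.symm i)
  have h2 : (integralBasis K).det v' = (integralBasis K).det b * b.det v' := by
    rw [Basis.det_apply, Basis.det_apply, Basis.det_apply, ← Matrix.det_mul,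
      Basis.toMatrix_mul_toMatrix]
  have h3 : |(integralBasis K).det b| = FractionalIdeal.absNorm A.1 :=
    det_basisOfFractionalIdeal_eq_absNorm K A e
  have h4 : Algebra.discr ℚ v = (integralBasis K).det v' ^ 2 * discr K := by
    rw [← Algebra.discr_reindex ℚ v f, coe_discr, ← Basis.coe_reindex, Basis.det_apply,
      ← Algebra.discr_of_matrix_vecMul, Basis.toMatrix_map_vecMul]
  rw [h4, abs_mul, abs_pow, h2, abs_mul, h3]
  have h5 := FractionalIdeal.absNorm_nonneg A.1
  gcongr
  exact le_mul_of_one_le_right h5 h1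

theorem abs_algebraDiscr_le_of_norm_embedding_le {ι : Type*} [Fintype ι] [DecidableEq ι]
    (v : Module.Basis ι ℚ K) {x : ℝ} (hx : ∀ i (φ : K →+* ℂ), ‖φ (v i)‖ ≤ x) :
    |(Algebra.discr ℚ v : ℝ)| ≤
      ((Module.finrank ℚ K).factorial * x ^ Module.finrank ℚ K) ^ 2 := by
  have hcard : Fintype.card ι = Module.finrank ℚ K := (finrank_eq_card_basis v).symm
  let e : ι ≃ (K →ₐ[ℚ] ℂ) := Fintype.equivOfCardEq (by rw [hcard, AlgHom.card])
  have h1 := Algebra.discr_eq_det_embeddingsMatrixReindex_pow_two ℚ ℂ v e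
  have h2 : ‖(Algebra.embeddingsMatrixReindex ℚ ℂ v e).det‖ ≤
      (Module.finrank ℚ K).factorial * x ^ Module.finrank ℚ K := by
    have := Matrix.det_le (A := Algebra.embeddingsMatrixReindex ℚ ℂ v e)
      (abv := NormedField.toAbsoluteValue ℂ) (x := x)
      (fun i j => hx i ((e j : K →ₐ[ℚ] ℂ) : K →+* ℂ))
    rw [hcard, nsmul_eq_mul] at this
    exact this
  have h3 : |(Algebra.discr ℚ v : ℝ)| = ‖algebraMap ℚ ℂ (Algebra.discr ℚ v)‖ := by
    rw [eq_ratCast, Complex.norm_ratCast]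
  rw [h3, h1, norm_pow]
  gcongr

open IntermediateField in
/-- The discriminant of `K` is bounded in terms of the height of a primitive element `β`: if `B` is
a denominator of `β`, then `1, β, …, β ^ (n - 1)` is a basis of `K` inside `B ^ (-(n - 1))`, whose
discriminant is at most `(n! T ^ (n (n - 1)))²`. -/
theorem abs_discr_le_of_adjoin_eq_top {β : K} (hβ : ℚ⟮β⟯ = ⊤) {T : ℝ} (hT : 1 ≤ T)
    (hw : ∀ w : InfinitePlace K, w β ≤ T) {B : Ideal (𝓞 K)} (hB : B ≠ ⊥)
    (hden : ∀ y ∈ B, ∃ z : 𝓞 K, (z : K) = β * y) :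
    |(discr K : ℝ)| ≤ ((Module.finrank ℚ K).factorial : ℝ) ^ 2 *
      (T ^ Module.finrank ℚ K * Ideal.absNorm B) ^ (2 * (Module.finrank ℚ K - 1)) := by
  set n := Module.finrank ℚ K with hn
  have hdeg : (minpoly ℚ β).natDegree = n :=
    (Field.primitive_element_iff_minpoly_natDegree_eq ℚ β).mp hβ
  have hli : LinearIndependent ℚ fun i : Fin (minpoly ℚ β).natDegree => β ^ (i : ℕ) :=
    linearIndependent_pow β
  have : Nonempty (Fin (minpoly ℚ β).natDegree) :=
    ⟨⟨0, by rw [hdeg]; exact Module.finrank_pos⟩⟩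
  let v := basisOfLinearIndependentOfCardEqFinrank hli (by rw [Fintype.card_fin, hdeg])
  have hv : ∀ i, v i = β ^ (i : ℕ) := fun i => by simp [v]
  have hB' : (B : FractionalIdeal (𝓞 K)⁰ K) ≠ 0 := by simpa using hB
  let A : (FractionalIdeal (𝓞 K)⁰ K)ˣ :=
    Units.mk0 (((B : FractionalIdeal (𝓞 K)⁰ K) ^ (n - 1))⁻¹) (inv_ne_zero (pow_ne_zero _ hB'))
  have hle : FractionalIdeal.spanSingleton (𝓞 K)⁰ β * (B : FractionalIdeal (𝓞 K)⁰ K) ≤ 1 := by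
    rw [FractionalIdeal.spanSingleton_mul_le_iff]
    intro y hy
    obtain ⟨y, hy', rfl⟩ := (FractionalIdeal.mem_coeIdeal _).mp hy
    obtain ⟨z, hz⟩ := hden y hy'
    exact (FractionalIdeal.mem_one_iff _).mpr ⟨z, hz⟩
  have hmem : ∀ i, v i ∈ (A : FractionalIdeal (𝓞 K)⁰ K) := by
    intro i
    have hi : (i : ℕ) + (n - 1 - i) = n - 1 := by
      have := i.2
      omega
    have h1 : FractionalIdeal.spanSingleton (𝓞 K)⁰ (β ^ (i : ℕ)) *
        (B : FractionalIdeal (𝓞 K)⁰ K) ^ (n - 1) ≤ 1 := by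
      rw [← hi, pow_add, ← mul_assoc, ← FractionalIdeal.spanSingleton_pow, ← mul_pow]
      exact mul_le_one' (pow_le_one' hle _) (pow_le_one' FractionalIdeal.coeIdeal_le_one _)
    rw [← FractionalIdeal.spanSingleton_le_iff_mem, hv]
    have h2 := mul_le_mul_left h1 (((B : FractionalIdeal (𝓞 K)⁰ K) ^ (n - 1))⁻¹)
    rwa [mul_assoc, mul_inv_cancel₀ (pow_ne_zero _ hB'), mul_one, one_mul] at h2
  have h1 := absNorm_sq_mul_abs_discr_le A v hmem
  have h2 := abs_algebraDiscr_le_of_norm_embedding_le v (x := T ^ (n - 1)) (by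
    intro i φ
    have hi : (i : ℕ) ≤ n - 1 := by
      have := i.2
      omega
    rw [hv, map_pow, norm_pow, ← InfinitePlace.apply]
    calc _ ≤ T ^ (i : ℕ) := by gcongr; exact hw _
      _ ≤ T ^ (n - 1) := pow_le_pow_right₀ hT hi)
  have hNA : FractionalIdeal.absNorm (A : FractionalIdeal (𝓞 K)⁰ K) =
      ((Ideal.absNorm B : ℚ) ^ (n - 1))⁻¹ := by
    simp only [A, Units.val_mk0, map_inv₀, map_pow, FractionalIdeal.coeIdeal_absNorm]
  have hNB : (0 : ℝ) < Ideal.absNorm B := by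
    exact_mod_cast Nat.pos_of_ne_zero (by rwa [Ne, Ideal.absNorm_eq_zero_iff])
  have h3 : (((Ideal.absNorm B : ℝ) ^ (n - 1))⁻¹) ^ 2 * |(discr K : ℝ)| ≤
      |(Algebra.discr ℚ v : ℝ)| := by
    rw [hNA] at h1
    have h0 : ((((((Ideal.absNorm B : ℚ) ^ (n - 1))⁻¹) ^ 2 * |(discr K : ℚ)| : ℚ)) : ℝ) ≤
        ((|Algebra.discr ℚ v| : ℚ) : ℝ) := Rat.cast_le.mpr h1
    push_cast at h0
    exact h0
  have h4 := h3.trans h2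
  rw [inv_pow, inv_mul_le_iff₀ (by positivity)] at h4
  refine h4.trans (le_of_eq ?_)
  simp only [← hn]
  rw [mul_pow _ (Ideal.absNorm B : ℝ), ← pow_mul T, pow_mul (Ideal.absNorm B : ℝ)]
  ring

end

/-! ### Counting ideals of bounded norm -/

section
variable (K : Type*) [Field K] [NumberField K]

open Module

/-- At most `[K : ℚ]` primes of `K` lie above a rational prime, so the primes of `K` can be labelled
by `Fin [K : ℚ]` in such a way that the primes above the same rational prime have distinct
labels. -/
theorem exists_label_injOn_primesOver :
    ∃ idx : Ideal (𝓞 K) → Fin (finrank ℚ K), ∀ p : ℕ, p.Prime →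
      Set.InjOn idx ((Ideal.span {(p : ℤ)}).primesOver (𝓞 K)) := by
  classical
  have : NeZero (finrank ℚ K) := ⟨finrank_pos.ne'⟩
  have key : ∀ p : Nat.Primes, ∃ f : Ideal (𝓞 K) → Fin (finrank ℚ K),
      Set.InjOn f ((Ideal.span {((p : ℕ) : ℤ)}).primesOver (𝓞 K)) := by
    intro ⟨p, hp⟩
    have hpZ : Prime (p : ℤ) := Nat.prime_iff_prime_int.mp hp
    set q : Ideal ℤ := Ideal.span {(p : ℤ)} with hq
    have hqp : q.IsPrime := (Ideal.span_singleton_prime hpZ.ne_zero).mpr hpZ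
    have : Fintype (q.primesOver (𝓞 K)) :=
      (Algebra.QuasiFinite.finite_primesOver q).fintype
    have hcard : Fintype.card (q.primesOver (𝓞 K)) ≤ Fintype.card (Fin (finrank ℚ K)) := by
      rw [Fintype.card_fin, ← RingOfIntegers.rank K,
        ← Ideal.sum_ramification_inertia_eq_finrank q (𝓞 K), ← Finset.card_univ,
        Finset.card_eq_sum_ones]
      refine Finset.sum_le_sum fun P _ => ?_
      have hPp : P.1.IsPrime := P.2.1
      exact Nat.mul_pos (Ideal.ramificationIdx_pos P.1 ℤ) (Ideal.inertiaDeg_pos P.1 ℤ)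
    obtain ⟨g⟩ := Function.Embedding.nonempty_of_card_le hcard
    refine ⟨fun P => if h : P ∈ q.primesOver (𝓞 K) then g ⟨P, h⟩ else 0, fun P hP Q hQ h => ?_⟩
    simp only [hP, hQ, dif_pos] at h
    exact congrArg Subtype.val (g.injective h)
  choose f hf using key
  -- the label of `P` is the one given by the rational prime below `P`
  refine ⟨fun P => if h : ∃ p : Nat.Primes, P ∈ (Ideal.span {((p : ℕ) : ℤ)}).primesOver (𝓞 K)
    then f h.choose P else 0, fun p hp P hP Q hQ h => ?_⟩
  have huniq : ∀ R, R ∈ (Ideal.span {(p : ℤ)}).primesOver (𝓞 K) →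
      ∀ p' : Nat.Primes, R ∈ (Ideal.span {((p' : ℕ) : ℤ)}).primesOver (𝓞 K) → p' = ⟨p, hp⟩ := by
    intro R hR p' hR'
    have h1 := hR.2.over.trans hR'.2.over.symm
    have h2 := Ideal.span_singleton_eq_span_singleton.mp h1
    have h3 := Int.natAbs_eq_iff_associated.mpr h2
    exact Subtype.ext (by simpa using h3.symm)
  have hP' : ∃ p : Nat.Primes, P ∈ (Ideal.span {((p : ℕ) : ℤ)}).primesOver (𝓞 K) := ⟨⟨p, hp⟩, hP⟩
  have hQ' : ∃ p : Nat.Primes, Q ∈ (Ideal.span {((p : ℕ) : ℤ)}).primesOver (𝓞 K) := ⟨⟨p, hp⟩, hQ⟩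
  simp only [dif_pos hP', dif_pos hQ'] at h
  rw [huniq P hP _ hP'.choose_spec, huniq Q hQ _ hQ'.choose_spec] at h
  exact hf ⟨p, hp⟩ hP hQ h

variable {K}

open UniqueFactorizationMonoid in
/-- The norm of the part of an ideal supported on the primes with a given label. -/
noncomputable def labelledNorm (idx : Ideal (𝓞 K) → Fin (finrank ℚ K)) (J : Ideal (𝓞 K)) :
    Fin (finrank ℚ K) → ℕ :=
  ((normalizedFactors J).map fun P => Pi.mulSingle (idx P) (Ideal.absNorm P)).prod

open UniqueFactorizationMonoid in
theorem prod_labelledNorm (idx : Ideal (𝓞 K) → Fin (finrank ℚ K)) {J : Ideal (𝓞 K)} (hJ : J ≠ 0) :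
    ∏ i, labelledNorm idx J i = Ideal.absNorm J := by
  have h1 : ∀ s : Multiset (Ideal (𝓞 K)),
      ∏ i, (s.map fun P => (Pi.mulSingle (idx P) (Ideal.absNorm P) : Fin (finrank ℚ K) → ℕ)).prod i
        = Ideal.absNorm s.prod := by
    intro s
    induction s using Multiset.induction_on with
    | empty => simp
    | cons P s ih =>
      simp only [Multiset.map_cons, Multiset.prod_cons, Pi.mul_apply, Finset.prod_mul_distrib,
        map_mul, ih, Finset.prod_pi_mulSingle', Finset.mem_univ, if_true]
  rw [labelledNorm, h1, associated_iff_eq.mp (prod_normalizedFactors hJ)]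

open UniqueFactorizationMonoid in
/-- An ideal is determined by the norms of its labelled parts, because at most one prime with a
given label lies above each rational prime. -/
theorem labelledNorm_injOn {idx : Ideal (𝓞 K) → Fin (finrank ℚ K)}
    (hidx : ∀ p : ℕ, p.Prime → Set.InjOn idx ((Ideal.span {(p : ℤ)}).primesOver (𝓞 K))) :
    Set.InjOn (labelledNorm idx) {J | J ≠ 0} := by
  classical
  -- the `p`-adic valuation of the norm with the label of `P` determines the exponent of `P`
  have key : ∀ (P : Ideal (𝓞 K)), Prime P → ∃ p : ℕ, p.Prime ∧ 0 < padicValNat p (Ideal.absNorm P) ∧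
      ∀ s : Multiset (Ideal (𝓞 K)), (∀ Q ∈ s, Prime Q) →
        (s.map fun Q =>
          (Pi.mulSingle (idx Q) (Ideal.absNorm Q) : Fin (finrank ℚ K) → ℕ)).prod (idx P) ≠ 0 ∧
        padicValNat p ((s.map fun Q =>
          (Pi.mulSingle (idx Q) (Ideal.absNorm Q) : Fin (finrank ℚ K) → ℕ)).prod (idx P)) =
          s.count P * padicValNat p (Ideal.absNorm P) := by
    intro P hP
    have hPp : P.IsPrime := Ideal.isPrime_of_prime hP
    have hnz : ∀ Q : Ideal (𝓞 K), Prime Q → Ideal.absNorm Q ≠ 0 := fun Q hQ => by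
      rw [Ne, Ideal.absNorm_eq_zero_iff]; exact hQ.ne_zero
    have habove : ∀ (p : ℕ), p.Prime → ∀ Q : Ideal (𝓞 K), Prime Q → p ∣ Ideal.absNorm Q →
        Q ∈ (Ideal.span {(p : ℤ)}).primesOver (𝓞 K) := by
      intro p hp Q hQ hpQ
      have hQp : Q.IsPrime := Ideal.isPrime_of_prime hQ
      obtain ⟨R, hR, hRp, hRQ⟩ := Ideal.exists_isMaximal_dvd_of_dvd_absNorm' hp Q hpQ
      obtain rfl : Q = R := (hQp.isMaximal hQ.ne_zero).eq_of_le hR.ne_top (Ideal.le_of_dvd hRQ)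
      exact ⟨hQp, ⟨hRp.symm⟩⟩
    obtain ⟨p, hp, hpP⟩ := Nat.exists_prime_and_dvd (n := Ideal.absNorm P)
      (by rw [Ne, Ideal.absNorm_eq_one_iff]; exact hPp.ne_top)
    have : Fact p.Prime := ⟨hp⟩
    refine ⟨p, hp, Nat.pos_of_ne_zero ((dvd_iff_padicValNat_ne_zero (hnz P hP)).mp hpP),
      fun s => ?_⟩
    induction s using Multiset.induction_on with
    | empty => intro _; simp
    | cons Q s ih =>
      intro hs
      obtain ⟨ih0, ih⟩ := ih fun R hR => hs R (Multiset.mem_cons_of_mem hR)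
      have hQ := hs Q (Multiset.mem_cons_self Q s)
      simp only [Multiset.map_cons, Multiset.prod_cons, Pi.mul_apply]
      by_cases hi : idx P = idx Q
      · rw [hi, Pi.mulSingle_eq_same, ← hi]
        refine ⟨mul_ne_zero (hnz Q hQ) ih0, ?_⟩
        rw [padicValNat.mul (hnz Q hQ) ih0, ih, Multiset.count_cons]
        by_cases hPQ : P = Q
        · rw [if_pos hPQ, ← hPQ]
          ring
        · rw [if_neg hPQ, padicValNat.eq_zero_of_not_dvd, zero_add, add_zero]
          intro hdvd
          exact hPQ (hidx p hp (habove p hp P hP hpP) (habove p hp Q hQ hdvd) hi)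
      · rw [Pi.mulSingle_eq_of_ne hi, one_mul]
        refine ⟨ih0, ?_⟩
        rw [ih, Multiset.count_cons_of_ne]
        rintro rfl
        exact hi rfl
  intro J hJ J' hJ' h
  have hcount : normalizedFactors J = normalizedFactors J' := by
    ext P
    by_cases hP : Prime P
    · obtain ⟨p, hp, hpos, hs⟩ := key P hP
      have h1 := (hs (normalizedFactors J) fun Q hQ => prime_of_normalized_factor Q hQ).2
      have h2 := (hs (normalizedFactors J') fun Q hQ => prime_of_normalized_factor Q hQ).2
      have h3 := congrFun h (idx P)
      simp only [labelledNorm] at h3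
      rw [h3, h2] at h1
      exact (Nat.eq_of_mul_eq_mul_right hpos h1).symm
    · rw [Multiset.count_eq_zero_of_notMem fun h => hP (prime_of_normalized_factor P h),
        Multiset.count_eq_zero_of_notMem fun h => hP (prime_of_normalized_factor P h)]
  rw [← associated_iff_eq.mp (prod_normalizedFactors hJ), hcount,
    associated_iff_eq.mp (prod_normalizedFactors hJ')]

/-- The number of nonzero ideals of norm at most `X` is at most `ζ(s)^n X^s` for every `s > 1`. This
is Rankin's trick, combined with the comparison of the Dedekind zeta function with `ζ(s)^n`. -/
theorem card_le_of_absNorm_le {s : ℝ} (hs : 1 < s) {X : ℝ} (hX : 0 ≤ X)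
    (W : Finset (Ideal (𝓞 K)))
    (hW : ∀ J ∈ W, J ≠ 0 ∧ (Ideal.absNorm J : ℝ) ≤ X) :
    (W.card : ℝ) ≤ (∑' m : ℕ, 1 / (m : ℝ) ^ s) ^ finrank ℚ K * X ^ s := by
  classical
  obtain ⟨idx, hidx⟩ := exists_label_injOn_primesOver K
  have hinj := labelledNorm_injOn hidx
  have hpos : ∀ J ∈ W, 0 < Ideal.absNorm J := fun J hJ =>
    Nat.pos_of_ne_zero (by rw [Ne, Ideal.absNorm_eq_zero_iff]; exact (hW J hJ).1)
  let u : ℕ → ℝ := fun m => 1 / (m : ℝ) ^ s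
  have hu : ∀ m, 0 ≤ u m := fun m => by positivity
  let N : Finset ℕ := Finset.Icc 1 ⌊X⌋₊
  have hmem : ∀ J ∈ W, labelledNorm idx J ∈ Fintype.piFinset fun _ => N := by
    intro J hJ
    rw [Fintype.mem_piFinset]
    intro i
    have hdvd : labelledNorm idx J i ∣ Ideal.absNorm J := by
      rw [← prod_labelledNorm idx (hW J hJ).1]
      exact Finset.dvd_prod_of_mem _ (Finset.mem_univ i)
    exact Finset.mem_Icc.mpr ⟨Nat.pos_of_dvd_of_pos hdvd (hpos J hJ),
      Nat.le_floor (le_trans (by exact_mod_cast Nat.le_of_dvd (hpos J hJ) hdvd) (hW J hJ).2)⟩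
  calc (W.card : ℝ) = ∑ J ∈ W, 1 := by simp
    _ ≤ ∑ J ∈ W, X ^ s * ∏ i, u (labelledNorm idx J i) := by
      refine Finset.sum_le_sum fun J hJ => ?_
      have h0 : (0 : ℝ) < Ideal.absNorm J := by exact_mod_cast hpos J hJ
      have h1 : ∏ i, u (labelledNorm idx J i) = 1 / (Ideal.absNorm J : ℝ) ^ s := by
        simp only [u, Finset.prod_div_distrib, Finset.prod_const_one]
        rw [Real.finsetProd_rpow _ _ fun i _ => Nat.cast_nonneg _]
        rw [← prod_labelledNorm idx (hW J hJ).1]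
        push_cast
        rfl
      rw [h1, mul_one_div, one_le_div (by positivity)]
      exact Real.rpow_le_rpow h0.le (hW J hJ).2 (by linarith)
    _ = X ^ s * ∑ t ∈ W.image (labelledNorm idx), ∏ i, u (t i) := by
      rw [Finset.sum_image fun J hJ J' hJ' h => hinj (hW J hJ).1 (hW J' hJ').1 h, Finset.mul_sum]
    _ ≤ X ^ s * ∑ t ∈ Fintype.piFinset fun _ : Fin (finrank ℚ K) => N, ∏ i, u (t i) := by
      gcongr
      intro t ht
      obtain ⟨J, hJ, rfl⟩ := Finset.mem_image.mp ht
      exact hmem J hJ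
    _ = X ^ s * (∑ m ∈ N, u m) ^ finrank ℚ K := by
      rw [← Finset.prod_univ_sum]
      simp
    _ ≤ X ^ s * (∑' m : ℕ, u m) ^ finrank ℚ K := by
      have : ∑ m ∈ N, u m ≤ ∑' m : ℕ, u m :=
        (Real.summable_one_div_nat_rpow.mpr hs).sum_le_tsum N fun m _ => hu m
      have h0 : 0 ≤ ∑ m ∈ N, u m := Finset.sum_nonneg fun m _ => hu m
      gcongr
    _ = _ := mul_comm _ _

end

/-! ### Minkowski's theorem for boxes -/

section
variable {K : Type*} [Field K] [NumberField K]
open Module MeasureTheory NumberField.InfinitePlace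
open scoped nonZeroDivisors NNReal ENNReal

/-- Minkowski's theorem for an integral ideal and a box with prescribed proportions. -/
theorem exists_mem_ideal_lt {A : Ideal (𝓞 K)} (hA : A ≠ ⊥) {f : InfinitePlace K → ℝ}
    (hf : ∀ w, 0 < f w)
    (hprod : ∏ w, f w ^ w.mult = 2 * √|(discr K : ℝ)| * Ideal.absNorm A) :
    ∃ α ∈ A, α ≠ 0 ∧ ∀ w : InfinitePlace K, w (α : K) < f w := by
  classical
  have hA' : (A : FractionalIdeal (𝓞 K)⁰ K) ≠ 0 := by simpa using hA
  obtain ⟨I, hI⟩ : ∃ I : (FractionalIdeal (𝓞 K)⁰ K)ˣ, (I : FractionalIdeal (𝓞 K)⁰ K) = A :=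
    ⟨Units.mk0 A hA', rfl⟩
  let g : InfinitePlace K → ℝ≥0 := fun w => ⟨f w, (hf w).le⟩
  have hNA : (0 : ℝ) < Ideal.absNorm A := by
    exact_mod_cast Nat.pos_of_ne_zero (by rwa [Ne, Ideal.absNorm_eq_zero_iff])
  have hD : 0 < √|(discr K : ℝ)| :=
    Real.sqrt_pos.mpr (abs_pos.mpr (by exact_mod_cast discr_ne_zero K))
  have h1 : mixedEmbedding.minkowskiBound K I = ENNReal.ofReal (Ideal.absNorm A *
      ((2⁻¹) ^ nrComplexPlaces K * √|(discr K : ℝ)|) * 2 ^ (finrank ℚ K)) := by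
    rw [mixedEmbedding.minkowskiBound,
      mixedEmbedding.volume_fundamentalDomain_fractionalIdealLatticeBasis,
      mixedEmbedding.volume_fundamentalDomain_latticeBasis, mixedEmbedding.finrank]
    rw [ENNReal.ofReal_mul (by positivity), ENNReal.ofReal_mul (by positivity),
      ENNReal.ofReal_mul (by positivity), ENNReal.ofReal_pow (by positivity),
      ENNReal.ofReal_pow (by positivity), ENNReal.ofReal_inv_of_pos two_pos, ENNReal.ofReal_ofNat]
    congr 3
    · simp [hI, FractionalIdeal.coeIdeal_absNorm]
    · rw [ENNReal.ofReal, Real.sqrt, Real.toNNReal_coe]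
      congr 2
      apply NNReal.coe_injective
      simp [Int.norm_eq_abs]
  have h2 : volume (mixedEmbedding.convexBodyLT K g) = ENNReal.ofReal
      ((2 ^ nrRealPlaces K * Real.pi ^ nrComplexPlaces K) *
        (2 * √|(discr K : ℝ)| * Ideal.absNorm A)) := by
    rw [mixedEmbedding.convexBodyLT_volume, ← hprod, ENNReal.ofReal, ← ENNReal.coe_mul]
    congr 1
    apply NNReal.coe_injective
    have h0 : 0 ≤ ∏ w, f w ^ w.mult := Finset.prod_nonneg fun w _ => pow_nonneg (hf w).le _
    rw [Real.coe_toNNReal _ (mul_nonneg (by positivity) h0)]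
    push_cast
    rfl
  obtain ⟨a, ha, ha0, hlt⟩ := mixedEmbedding.exists_ne_zero_mem_ideal_lt K I (f := g) (by
    rw [h1, h2]
    refine (ENNReal.ofReal_lt_ofReal_iff (by positivity)).mpr ?_
    have h3 := card_add_two_mul_card_eq_rank K
    rw [← h3, pow_add, pow_mul, inv_pow]
    have h4 : (2 : ℝ) ^ nrComplexPlaces K ≤ Real.pi ^ nrComplexPlaces K := by
      gcongr
      exact Real.two_le_pi
    have h5 : ((2 : ℝ) ^ 2) ^ nrComplexPlaces K =
        2 ^ nrComplexPlaces K * 2 ^ nrComplexPlaces K := by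
      rw [← pow_mul, ← pow_add]
      congr 1
      ring
    rw [h5]
    have h6 : (0 : ℝ) < 2 ^ nrComplexPlaces K := by positivity
    have h7 : (0 : ℝ) < 2 ^ nrRealPlaces K := by positivity
    calc _ = 2 ^ nrRealPlaces K * 2 ^ nrComplexPlaces K *
          (√|(discr K : ℝ)| * Ideal.absNorm A) := by field_simp
      _ < 2 ^ nrRealPlaces K * 2 ^ nrComplexPlaces K *
          (2 * √|(discr K : ℝ)| * Ideal.absNorm A) := by
        have : 0 < √|(discr K : ℝ)| * Ideal.absNorm A := by positivity
        gcongr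
        linarith
      _ ≤ _ := by gcongr)
  rw [hI] at ha
  obtain ⟨α, hα, rfl⟩ := (FractionalIdeal.mem_coeIdeal _).mp ha
  exact ⟨α, hα, by simpa using ha0, hlt⟩
end

/-! ### Reduced representatives of ideal classes -/

theorem exists_coe_eq_div_mul_of_mem {F : Type*} [Field F] {x y z : 𝓞 F} (hy : y ≠ 0)
    {A B : Ideal (𝓞 F)}
    (h : Ideal.span {x} * A = Ideal.span {y} * B) (hz : z ∈ A) :
    ∃ u : 𝓞 F, (u : F) = (x : F) / y * z := by
  have hy' : (y : F) ≠ 0 := by simpa using hy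
  have h1 : x * z ∈ Ideal.span {y} * B := by
    rw [← h]
    exact Ideal.mul_mem_mul (Ideal.mem_span_singleton_self x) hz
  have h2 : x * z ∈ Ideal.span {y} := Ideal.mul_le_left h1
  rw [Ideal.mem_span_singleton] at h2
  obtain ⟨u, hu⟩ := h2
  refine ⟨u, ?_⟩
  have h3 : (x : F) * z = y * u := by
    simpa only [map_mul] using congrArg (algebraMap (𝓞 F) F) hu
  rw [div_mul_eq_mul_div, h3, mul_div_cancel_left₀ _ hy']

section
variable {K : Type*} [Field K] [NumberField K]
open Module NumberField.InfinitePlace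

theorem abs_norm_eq_absNorm_span (α : 𝓞 K) :
    ((|Algebra.norm ℚ (α : K)| : ℚ) : ℝ) = Ideal.absNorm (Ideal.span {α}) := by
  rw [Ideal.absNorm_span_singleton, ← Algebra.coe_norm_int, Nat.cast_natAbs]
  push_cast
  rfl

/-- Reduction of the ideal class of `b * I`, where `b ^ ℓ = (γ)`: it contains the inverse of an
integral ideal `J` of norm at most `2 √|disc K|`, and a generator `α` of `b * I * J` can be chosen
so that all its absolute values are close to those of `γ ^ (1 / ℓ)`, up to a common scaling. The
numbers `t w` measure the discrepancy. -/
theorem exists_span_singleton_eq_mul_of_pow_eq {ℓ : ℕ} (hℓ : ℓ ≠ 0) {b I : Ideal (𝓞 K)}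
    (hb : b ≠ ⊥) (hI : I ≠ ⊥) {γ : 𝓞 K} (hγ : b ^ ℓ = Ideal.span {γ}) :
    ∃ (α : 𝓞 K) (J : Ideal (𝓞 K)) (t : InfinitePlace K → ℝ),
      α ≠ 0 ∧ Ideal.span {α} = b * I * J ∧ J ≠ ⊥ ∧
      (Ideal.absNorm J : ℝ) ≤ 2 * √|(discr K : ℝ)| ∧
      ∀ w : InfinitePlace K, 1 ≤ 2 * √|(discr K : ℝ)| * t w ∧ t w ≤ 1 ∧
        w (α : K) ^ ℓ = t w ^ ℓ * w (γ : K) *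
          (2 * √|(discr K : ℝ)| * Ideal.absNorm I) ^ ((ℓ : ℝ) / finrank ℚ K) := by
  set n := finrank ℚ K with hn
  have hn0 : (n : ℝ) ≠ 0 := by exact_mod_cast (finrank_pos (R := ℚ) (M := K)).ne'
  have hℓ0 : (ℓ : ℝ) ≠ 0 := by exact_mod_cast hℓ
  set E := 2 * √|(discr K : ℝ)| with hE
  have hE0 : 0 < E :=
    mul_pos two_pos (Real.sqrt_pos.mpr (abs_pos.mpr (by exact_mod_cast discr_ne_zero K)))
  have hN : ∀ J : Ideal (𝓞 K), J ≠ ⊥ → (0 : ℝ) < Ideal.absNorm J := fun J hJ => by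
    exact_mod_cast Nat.pos_of_ne_zero (by rwa [Ne, Ideal.absNorm_eq_zero_iff])
  have hγ0 : γ ≠ 0 := by
    rintro rfl
    rw [Ideal.span_singleton_zero] at hγ
    exact pow_ne_zero ℓ hb hγ
  have hwγ : ∀ w : InfinitePlace K, 0 < w (γ : K) := fun w => pos_iff.mpr (by simpa using hγ0)
  -- the sides of a box that Minkowski's theorem applies to, since `∏ |γ|_w ^ (1 / ℓ) = N b`
  let f : InfinitePlace K → ℝ := fun w =>
    w (γ : K) ^ (1 / (ℓ : ℝ)) * (E * Ideal.absNorm I) ^ (1 / (n : ℝ))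
  have hEI : 0 < E * Ideal.absNorm I := mul_pos hE0 (hN I hI)
  have hf : ∀ w, 0 < f w := fun w =>
    mul_pos (Real.rpow_pos_of_pos (hwγ w) _) (Real.rpow_pos_of_pos hEI _)
  have hprod : ∏ w, f w ^ w.mult = E * Ideal.absNorm (b * I) := by
    have h1 : ∏ w : InfinitePlace K, (w (γ : K) ^ (1 / (ℓ : ℝ))) ^ w.mult = Ideal.absNorm b := by
      calc _ = ∏ w : InfinitePlace K, (w (γ : K) ^ w.mult) ^ (1 / (ℓ : ℝ)) := by
            refine Finset.prod_congr rfl fun w _ => ?_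
            rw [← Real.rpow_natCast, ← Real.rpow_mul (hwγ w).le, mul_comm,
              Real.rpow_mul (hwγ w).le, Real.rpow_natCast]
        _ = (Ideal.absNorm (b ^ ℓ) : ℝ) ^ (1 / (ℓ : ℝ)) := by
            rw [Real.finsetProd_rpow _ _ fun w _ => pow_nonneg (hwγ w).le _,
              prod_eq_abs_norm, abs_norm_eq_absNorm_span, hγ]
        _ = _ := by
            rw [map_pow, Nat.cast_pow, ← Real.rpow_natCast, ← Real.rpow_mul (hN b hb).le,
              mul_one_div_cancel hℓ0, Real.rpow_one]
    have h2 : ∏ w : InfinitePlace K, ((E * Ideal.absNorm I) ^ (1 / (n : ℝ))) ^ w.mult =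
        E * Ideal.absNorm I := by
      rw [Finset.prod_pow_eq_pow_sum, sum_mult_eq, ← hn, ← Real.rpow_natCast,
        ← Real.rpow_mul hEI.le, one_div_mul_cancel hn0, Real.rpow_one]
    simp only [f, mul_pow, Finset.prod_mul_distrib]
    rw [h1, h2, map_mul, Nat.cast_mul]
    ring
  obtain ⟨α, hαA, hα0, hlt⟩ := exists_mem_ideal_lt (mul_ne_zero hb hI) hf hprod
  obtain ⟨J, hJ⟩ := Ideal.dvd_span_singleton.mpr hαA
  have hJ0 : J ≠ ⊥ := by
    rintro rfl
    rw [Ideal.mul_bot, Ideal.span_singleton_eq_bot] at hJ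
    exact hα0 hJ
  let t : InfinitePlace K → ℝ := fun w => w (α : K) / f w
  have ht0 : ∀ w, 0 < t w := fun w => div_pos (pos_iff.mpr (by simpa using hα0)) (hf w)
  have ht1 : ∀ w, t w ≤ 1 := fun w => (div_le_one (hf w)).mpr (hlt w).le
  have htprod : E * ∏ w, t w ^ w.mult = Ideal.absNorm J := by
    have h0 := hN (b * I) (mul_ne_zero hb hI)
    simp only [t, div_pow, Finset.prod_div_distrib]
    rw [hprod, prod_eq_abs_norm, abs_norm_eq_absNorm_span, hJ, map_mul, Nat.cast_mul]
    field_simp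
  have hJ1 : (1 : ℝ) ≤ Ideal.absNorm J := by
    exact_mod_cast Nat.pos_of_ne_zero (by rwa [Ne, Ideal.absNorm_eq_zero_iff])
  refine ⟨α, J, t, hα0, hJ, hJ0, ?_, fun w => ⟨?_, ht1 w, ?_⟩⟩
  · rw [← htprod]
    exact mul_le_of_le_one_right hE0.le
      (Finset.prod_le_one (fun w _ => pow_nonneg (ht0 w).le _)
        fun w _ => pow_le_one₀ (ht0 w).le (ht1 w))
  · have h1 : ∏ w, t w ^ w.mult ≤ t w := by
      classical
      rw [← Finset.mul_prod_erase _ _ (Finset.mem_univ w)]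
      calc _ ≤ t w ^ w.mult * 1 := by
            refine mul_le_mul_of_nonneg_left ?_ (pow_nonneg (ht0 w).le _)
            exact Finset.prod_le_one (fun w _ => pow_nonneg (ht0 w).le _)
              fun w _ => pow_le_one₀ (ht0 w).le (ht1 w)
        _ ≤ t w := by
            rw [mul_one]
            exact pow_le_of_le_one (ht0 w).le (ht1 w) mult_ne_zero
    calc (1 : ℝ) ≤ E * ∏ w, t w ^ w.mult := htprod ▸ hJ1
      _ ≤ E * t w := by gcongr
  · have h1 : w (α : K) = t w * f w := (div_mul_cancel₀ _ (hf w).ne').symm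
    rw [h1]
    simp only [f]
    rw [mul_pow, mul_pow, ← Real.rpow_natCast (w (γ : K) ^ (1 / (ℓ : ℝ))),
      ← Real.rpow_mul (hwγ w).le, one_div_mul_cancel hℓ0, Real.rpow_one,
      ← Real.rpow_natCast ((E * (Ideal.absNorm I : ℝ)) ^ (1 / (n : ℝ))), ← Real.rpow_mul hEI.le,
      one_div_mul_eq_div]
    exact (mul_assoc _ _ _).symm

/-- Two reductions with the same `J` and nearly the same parameters `t` give rise to a primitive
element `α ^ ℓ γ' / (α' ^ ℓ γ)` of small height, which bounds the discriminant. -/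
theorem abs_discr_le_of_span_singleton_eq_mul {ℓ : ℕ} (hℓ : ℓ ≠ 0) {b b' I I' J : Ideal (𝓞 K)}
    {γ γ' α α' : 𝓞 K} {t t' : InfinitePlace K → ℝ} {R Y E : ℝ} (hE : 0 < E) (hR : 1 ≤ R)
    (hγ0 : γ ≠ 0) (hγ0' : γ' ≠ 0) (hα0 : α ≠ 0) (hα0' : α' ≠ 0)
    (hγ : b ^ ℓ = Ideal.span {γ}) (hγ' : b' ^ ℓ = Ideal.span {γ'})
    (hα : Ideal.span {α} = b * I * J) (hα' : Ideal.span {α'} = b' * I' * J)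
    (ht : ∀ w : InfinitePlace K, w (α : K) ^ ℓ = t w ^ ℓ * w (γ : K) *
      (E * Ideal.absNorm I) ^ ((ℓ : ℝ) / finrank ℚ K))
    (ht' : ∀ w : InfinitePlace K, w (α' : K) ^ ℓ = t' w ^ ℓ * w (γ' : K) *
      (E * Ideal.absNorm I') ^ ((ℓ : ℝ) / finrank ℚ K))
    (htpos : ∀ w, 0 < t w) (htpos' : ∀ w, 0 < t' w) (htt' : ∀ w, t w ≤ R * t' w)
    (hne : I ≠ I') (hI : Squarefree (Ideal.absNorm I))
    (hdisc : Nat.Coprime (Ideal.absNorm I) (discr K).natAbs)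
    (hI' : Squarefree (Ideal.absNorm I'))
    (hdisc' : Nat.Coprime (Ideal.absNorm I') (discr K).natAbs)
    (hY : (Ideal.absNorm I : ℝ) ≤ Y) (hY' : (Ideal.absNorm I' : ℝ) ≤ Y) :
    |(discr K : ℝ)| ≤ ((finrank ℚ K).factorial : ℝ) ^ 2 *
      (R ^ (ℓ * finrank ℚ K) * Y ^ ℓ) ^ (2 * (finrank ℚ K - 1)) := by
  set n := finrank ℚ K with hn
  have hn0 : (n : ℝ) ≠ 0 := by exact_mod_cast (finrank_pos (R := ℚ) (M := K)).ne'
  have hN : (0 : ℝ) < Ideal.absNorm I := by exact_mod_cast Nat.pos_of_ne_zero hI.ne_zero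
  have hN' : (0 : ℝ) < Ideal.absNorm I' := by exact_mod_cast Nat.pos_of_ne_zero hI'.ne_zero
  have hpos : ∀ (x : 𝓞 K), x ≠ 0 → ∀ w : InfinitePlace K, 0 < w (x : K) := fun x hx w =>
    pos_iff.mpr (by simpa using hx)
  obtain ⟨x, hx⟩ : ∃ x, x = α ^ ℓ * γ' := ⟨_, rfl⟩
  obtain ⟨y, hy⟩ : ∃ y, y = α' ^ ℓ * γ := ⟨_, rfl⟩
  have hx0 : x ≠ 0 := hx ▸ mul_ne_zero (pow_ne_zero _ hα0) hγ0'
  have hy0 : y ≠ 0 := hy ▸ mul_ne_zero (pow_ne_zero _ hα0') hγ0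
  have hy0' : (y : K) ≠ 0 := by simpa using hy0
  have heq : Ideal.span {x} * I' ^ ℓ = Ideal.span {y} * I ^ ℓ := by
    rw [hx, hy, ← Ideal.span_singleton_mul_span_singleton,
      ← Ideal.span_singleton_mul_span_singleton,
      ← Ideal.span_singleton_pow, ← Ideal.span_singleton_pow, ← hγ, ← hγ', hα, hα']
    ring
  have htop := adjoin_eq_top_of_span_mul_pow_eq hℓ hx0 hy0 hne heq hI hdisc hI' hdisc'
  -- `T` bounds the absolute values of `x / y`; the maximum with `1` makes `1 ≤ T`
  set ρ : ℝ := max 1 ((Ideal.absNorm I : ℝ) / Ideal.absNorm I') with hρ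
  have hρ1 : 1 ≤ ρ := le_max_left _ _
  set T : ℝ := R ^ ℓ * ρ ^ ((ℓ : ℝ) / n) with hT
  have hT1 : 1 ≤ T :=
    one_le_mul_of_one_le_of_one_le (one_le_pow₀ hR) (Real.one_le_rpow hρ1 (by positivity))
  have hden : ∀ z ∈ I' ^ ℓ, ∃ u : 𝓞 K, (u : K) = (x : K) / y * z :=
    fun z hz => exists_coe_eq_div_mul_of_mem hy0 heq hz
  have hw : ∀ w : InfinitePlace K, w ((x : K) / y) ≤ T := by
    intro w
    have hγw := hpos γ hγ0 w
    have hγw' := hpos γ' hγ0' w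
    have h1 : w (x : K) = w (α : K) ^ ℓ * w (γ' : K) := by
      rw [hx]
      push_cast
      rw [map_mul, map_pow]
    have h2 : w (y : K) = w (α' : K) ^ ℓ * w (γ : K) := by
      rw [hy]
      push_cast
      rw [map_mul, map_pow]
    rw [map_div₀, div_le_iff₀ (hpos y hy0 w), h1, h2, ht w, ht' w,
      Real.mul_rpow hE.le hN.le, Real.mul_rpow hE.le hN'.le, hT]
    have h3 : t w ^ ℓ ≤ R ^ ℓ * t' w ^ ℓ := by
      rw [← mul_pow]
      exact pow_le_pow_left₀ (htpos w).le (htt' w) ℓ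
    have h4 : (Ideal.absNorm I : ℝ) ^ ((ℓ : ℝ) / n) ≤
        ρ ^ ((ℓ : ℝ) / n) * (Ideal.absNorm I' : ℝ) ^ ((ℓ : ℝ) / n) := by
      rw [← Real.mul_rpow (by positivity) hN'.le]
      refine Real.rpow_le_rpow hN.le ?_ (by positivity)
      rw [← div_le_iff₀ hN']
      exact le_max_right _ _
    have h5 : 0 < E ^ ((ℓ : ℝ) / n) := Real.rpow_pos_of_pos hE _
    have h6 := (htpos' w).le
    calc _ = t w ^ ℓ * (Ideal.absNorm I : ℝ) ^ ((ℓ : ℝ) / n) *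
          (w (γ : K) * w (γ' : K) * E ^ ((ℓ : ℝ) / n)) := by ring
      _ ≤ (R ^ ℓ * t' w ^ ℓ) *
          (ρ ^ ((ℓ : ℝ) / n) * (Ideal.absNorm I' : ℝ) ^ ((ℓ : ℝ) / n)) *
          (w (γ : K) * w (γ' : K) * E ^ ((ℓ : ℝ) / n)) := by gcongr
      _ = _ := by ring
  have hI'0 : I' ≠ ⊥ := by
    rintro rfl
    simp at hN'
  have hmain := abs_discr_le_of_adjoin_eq_top htop hT1 hw (pow_ne_zero ℓ hI'0) hden
  rw [← hn] at hmain
  refine hmain.trans ?_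
  have h1 : T ^ n * (Ideal.absNorm (I' ^ ℓ) : ℝ) ≤ R ^ (ℓ * n) * Y ^ ℓ := by
    have h2 : T ^ n = R ^ (ℓ * n) * ρ ^ ℓ := by
      rw [hT, mul_pow, ← pow_mul, ← Real.rpow_natCast (ρ ^ ((ℓ : ℝ) / n)),
        ← Real.rpow_mul (by positivity), div_mul_cancel₀ _ hn0, Real.rpow_natCast]
    rw [h2, map_pow, Nat.cast_pow, mul_assoc, ← mul_pow]
    have h3 : ρ * Ideal.absNorm I' ≤ Y := by
      rw [hρ, max_mul_of_nonneg _ _ hN'.le, one_mul, div_mul_cancel₀ _ hN'.ne']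
      exact max_le hY' hY
    gcongr
  gcongr
end

/-! ### Counting torsion classes -/

/-- Two numbers of `(0, 1]` whose logarithms have the same integral part in units of `log R` differ
by a factor at most `R`. -/
theorem le_mul_of_floor_eq {t t' R : ℝ} (hR : 1 < R) (ht : 0 < t) (ht1 : t ≤ 1) (ht' : 0 < t')
    (h : ⌊-Real.log t / Real.log R⌋₊ = ⌊-Real.log t' / Real.log R⌋₊) : t ≤ R * t' := by
  have hL : 0 < Real.log R := Real.log_pos hR
  have hR0 : 0 < R := by linarith
  rw [← Real.log_le_log_iff ht (mul_pos hR0 ht'), Real.log_mul hR0.ne' ht'.ne']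
  by_contra! hlt
  have h1 : -Real.log t / Real.log R + 1 < -Real.log t' / Real.log R := by
    rw [div_add_one hL.ne']
    gcongr
    linarith
  have h0 : 0 ≤ -Real.log t / Real.log R :=
    div_nonneg (neg_nonneg.mpr (Real.log_nonpos ht.le ht1)) hL.le
  have h2 := Nat.floor_le h0
  have h3 := Nat.lt_floor_add_one (-Real.log t' / Real.log R)
  rw [h] at h2
  linarith

section
variable {K : Type*} [Field K] [NumberField K]
open Module NumberField.InfinitePlace
open scoped nonZeroDivisors

theorem card_infinitePlace_le_finrank : Fintype.card (InfinitePlace K) ≤ finrank ℚ K := by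
  rw [← sum_mult_eq, ← Finset.card_univ, Finset.card_eq_sum_ones]
  exact Finset.sum_le_sum fun w _ => mult_pos

/-- A class of order dividing `ℓ` is represented by an integral ideal with principal `ℓ`-th
power. -/
theorem exists_mk0_eq_and_pow_eq_span {ℓ : ℕ} (c : classGroupTorsion K ℓ) :
    ∃ (b : (Ideal (𝓞 K))⁰) (γ : 𝓞 K), ClassGroup.mk0 b = c ∧
      (b : Ideal (𝓞 K)) ^ ℓ = Ideal.span {γ} := by
  obtain ⟨b, hb⟩ := ClassGroup.mk0_surjective (c : ClassGroup (𝓞 K))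
  have h1 : ClassGroup.mk0 (b ^ ℓ) = 1 := by
    rw [map_pow, hb]
    exact c.2
  obtain ⟨γ, hγ⟩ := (ClassGroup.mk0_eq_one_iff (b ^ ℓ).2).mp h1
  exact ⟨b, γ, hb, hγ⟩

/-- If distinct ideals of `S` cannot collide, the classes of order dividing `ℓ` times the ideals of
`S` inject into the ideals of norm at most `2 √|disc K|`, up to boundedly many boxes. -/
theorem hTorsion_mul_card_le {ℓ : ℕ} (hℓ : ℓ ≠ 0) (hD : 2 ≤ |(discr K : ℝ)|) {η : ℝ} (hη : 0 < η)
    {S : Finset (Ideal (𝓞 K))} {Y : ℝ}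
    (hS : ∀ I ∈ S, Squarefree (Ideal.absNorm I) ∧
      Nat.Coprime (Ideal.absNorm I) (discr K).natAbs ∧ (Ideal.absNorm I : ℝ) ≤ Y)
    (hsep : (∀ I ∈ S, ∀ I' ∈ S, I = I') ∨ ((finrank ℚ K).factorial : ℝ) ^ 2 *
      ((|(discr K : ℝ)| ^ η) ^ (ℓ * finrank ℚ K) * Y ^ ℓ) ^ (2 * (finrank ℚ K - 1)) <
        |(discr K : ℝ)|) {s : ℝ} (hs : 1 < s) :
    (hTorsion K ℓ * S.card : ℝ) ≤ (∑' m : ℕ, 1 / (m : ℝ) ^ s) ^ finrank ℚ K *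
      (2 * √|(discr K : ℝ)|) ^ s * ((⌊2 / η⌋₊ + 1 : ℕ) : ℝ) ^ finrank ℚ K := by
  classical
  set D := |(discr K : ℝ)| with hDdef
  set E := 2 * √D with hE
  have hE0 : 0 < E := mul_pos two_pos (Real.sqrt_pos.mpr (by linarith))
  have hR : 1 < D ^ η := Real.one_lt_rpow (by linarith) hη
  have hlogD : 0 < Real.log D := Real.log_pos (by linarith)
  have hlogR : Real.log (D ^ η) = η * Real.log D := Real.log_rpow (by linarith) η
  have hI0 : ∀ I ∈ S, I ≠ ⊥ := by
    rintro I hI rfl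
    simpa using (hS ⊥ hI).1.ne_zero
  choose b γ hbc hγ using fun c : classGroupTorsion K ℓ => exists_mk0_eq_and_pow_eq_span c
  have hb0 : ∀ c, (b c : Ideal (𝓞 K)) ≠ ⊥ := fun c => nonZeroDivisors.coe_ne_zero (b c)
  have hγ0 : ∀ c, γ c ≠ 0 := by
    intro c h
    have h1 := hγ c
    rw [h, Ideal.span_singleton_zero] at h1
    exact pow_ne_zero ℓ (hb0 c) h1
  choose α J t hα0 hα hJ0 hJ ht using fun x : classGroupTorsion K ℓ × S =>
    exists_span_singleton_eq_mul_of_pow_eq hℓ (hb0 x.1) (hI0 _ x.2.2) (hγ x.1)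
  have htpos : ∀ x w, 0 < t x w := fun x w =>
    pos_of_mul_pos_right (lt_of_lt_of_le one_pos (ht x w).1) hE0.le
  let W : Finset (Ideal (𝓞 K)) :=
    (Ideal.finite_setOfPred_absNorm_le ⌊E⌋₊).toFinset.filter (· ≠ 0)
  have hW : ∀ I ∈ W, I ≠ 0 ∧ (Ideal.absNorm I : ℝ) ≤ E := by
    intro I hI
    obtain ⟨h1, h2⟩ := Finset.mem_filter.mp hI
    have h3 : Ideal.absNorm I ≤ ⌊E⌋₊ := by simpa using h1
    exact ⟨h2, (Nat.le_floor_iff hE0.le).mp h3⟩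
  have hJW : ∀ x, J x ∈ W := by
    intro x
    refine Finset.mem_filter.mpr ⟨?_, hJ0 x⟩
    have := Nat.le_floor (hJ x)
    simpa using this
  have hbin : ∀ x w, ⌊-Real.log (t x w) / Real.log (D ^ η)⌋₊ < ⌊2 / η⌋₊ + 1 := by
    intro x w
    refine Nat.lt_succ_of_le (Nat.floor_le_floor ?_)
    rw [hlogR, div_le_div_iff₀ (mul_pos hη hlogD) hη]
    have h1 : 1 ≤ D ^ 2 * t x w := by
      refine (ht x w).1.trans ?_
      have h2 : √D ≤ D := Real.sqrt_le_iff.mpr ⟨by linarith, by nlinarith⟩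
      have h3 : E ≤ D ^ 2 := by
        rw [hE, pow_two]
        gcongr
      exact mul_le_mul_of_nonneg_right h3 (htpos x w).le
    have h2 := Real.log_nonneg h1
    rw [Real.log_mul (by positivity) (htpos x w).ne', Real.log_pow] at h2
    push_cast at h2
    nlinarith
  let Φ : classGroupTorsion K ℓ × S → W × (InfinitePlace K → Fin (⌊2 / η⌋₊ + 1)) := fun x =>
    (⟨J x, hJW x⟩, fun w => ⟨_, hbin x w⟩)
  have hinj : Function.Injective Φ := by
    intro x y hxy
    have hJxy : J x = J y := congrArg (fun z => (z.1 : Ideal (𝓞 K))) hxy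
    have hfl : ∀ w, ⌊-Real.log (t x w) / Real.log (D ^ η)⌋₊ =
        ⌊-Real.log (t y w) / Real.log (D ^ η)⌋₊ := fun w =>
      congrArg (fun z => ((z.2 w : Fin _) : ℕ)) hxy
    have hII : (x.2 : Ideal (𝓞 K)) = y.2 := by
      rcases hsep with hsep | hsep
      · exact hsep _ x.2.2 _ y.2.2
      by_contra hne
      obtain ⟨hx1, hx2, hx3⟩ := hS _ x.2.2
      obtain ⟨hy1, hy2, hy3⟩ := hS _ y.2.2
      refine absurd hsep (not_lt.mpr ?_)
      exact abs_discr_le_of_span_singleton_eq_mul hℓ hE0 hR.le (hγ0 x.1) (hγ0 y.1) (hα0 x) (hα0 y)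
        (hγ x.1) (hγ y.1) (hα x) (hJxy ▸ hα y) (fun w => (ht x w).2.2) (fun w => (ht y w).2.2)
        (htpos x) (htpos y)
        (fun w => le_mul_of_floor_eq hR (htpos x w) (ht x w).2.1 (htpos y w)
          (hfl w))
        hne hx1 hx2 hy1 hy2 hx3 hy3
    -- the class of `b` is determined by `I` and `J`
    have hcc : ClassGroup.mk0 (b x.1) = ClassGroup.mk0 (b y.1) := by
      have hIJ0 : (x.2 : Ideal (𝓞 K)) * J x ≠ 0 := mul_ne_zero (hI0 _ x.2.2) (hJ0 x)
      let B : (Ideal (𝓞 K))⁰ := ⟨x.2 * J x, mem_nonZeroDivisors_of_ne_zero hIJ0⟩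
      have h1 : ClassGroup.mk0 (b x.1) = (ClassGroup.mk0 B)⁻¹ :=
        ClassGroup.mk0_eq_mk0_inv_iff.mpr ⟨α x, hα0 x, by rw [hα x, mul_assoc]⟩
      have h2 : ClassGroup.mk0 (b y.1) = (ClassGroup.mk0 B)⁻¹ :=
        ClassGroup.mk0_eq_mk0_inv_iff.mpr ⟨α y, hα0 y, by rw [hα y, mul_assoc, ← hII, ← hJxy]⟩
      rw [h1, h2]
    rw [hbc, hbc] at hcc
    exact Prod.ext (Subtype.ext hcc) (Subtype.ext hII)
  have hcard := Nat.card_le_card_of_injective Φ hinj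
  rw [Nat.card_prod, Nat.card_prod, Nat.card_fun, Nat.card_eq_fintype_card (α := S),
    Nat.card_eq_fintype_card (α := W), Nat.card_eq_fintype_card (α := InfinitePlace K),
    Nat.card_eq_fintype_card (α := Fin _), Fintype.card_coe, Fintype.card_coe, Fintype.card_fin]
    at hcard
  have hcount := card_le_of_absNorm_le hs hE0.le W hW
  calc (hTorsion K ℓ * S.card : ℝ)
      ≤ W.card * ((⌊2 / η⌋₊ + 1 : ℕ) : ℝ) ^ Fintype.card (InfinitePlace K) := by
        exact_mod_cast hcard
    _ ≤ _ := by
        have h1 : (1 : ℝ) ≤ ((⌊2 / η⌋₊ + 1 : ℕ) : ℝ) := by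
          push_cast
          linarith [Nat.cast_nonneg (α := ℝ) ⌊2 / η⌋₊]
        exact mul_le_mul hcount (pow_le_pow_right₀ h1 card_infinitePlace_le_finrank)
          (by positivity) (le_trans (Nat.cast_nonneg _) hcount)
end

/-! ### The bound for the torsion of the class group -/

theorem abs_discr_eq_one_of_finrank_eq_one {K : Type*} [Field K] [NumberField K]
    (h : Module.finrank ℚ K = 1) : |(discr K : ℝ)| = 1 := by
  have hbij : Function.Bijective (Algebra.ofId ℚ K) := by
    refine ⟨(algebraMap ℚ K).injective, fun x => ?_⟩
    obtain ⟨y, hy⟩ := Algebra.mem_bot.mp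
      (Subalgebra.bot_eq_top_of_finrank_eq_one h ▸ Algebra.mem_top : x ∈ (⊥ : Subalgebra ℚ K))
    exact ⟨y, hy⟩
  rw [← discr_eq_discr_of_algEquiv ℚ (AlgEquiv.ofBijective _ hbij), discr_rat]
  simp

theorem hTorsion_eq_one_of_finrank_eq_one {K : Type*} [Field K] [NumberField K]
    (h : Module.finrank ℚ K = 1) (ℓ : ℕ) : hTorsion K ℓ = 1 := by
  have hD := abs_discr_eq_one_of_finrank_eq_one h
  have hpid : IsPrincipalIdealRing (𝓞 K) := by
    apply RingOfIntegers.isPrincipalIdealRing_of_abs_discr_lt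
    have h0 := InfinitePlace.nrComplexPlaces_eq_zero_of_finrank_eq_one h
    rw [h, h0]
    push_cast
    rw [hD]
    norm_num
  have : Subsingleton (ClassGroup (𝓞 K)) :=
    Fintype.card_le_one_iff_subsingleton.mp (card_classGroup_eq_one_iff.mpr hpid).le
  exact Nat.card_unique

theorem mainTheorem10 (n ℓ : ℕ) (hℓ : ℓ.Prime) (ε ϖ : ℝ) (hε : 0 < ε)
    (hϖ : n = 1 ∨ ϖ < 1 / (2 * (ℓ : ℝ) * ((n : ℝ) - 1))) :
    ∃ C : ℝ, 0 < C ∧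
      ∀ (K : Type*) [Field K] [NumberField K], Module.finrank ℚ K = n →
        ∀ (M : ℕ), 1 ≤ M → ∀ S : Finset (Ideal (𝓞 K)), S.card = M →
          (∀ I ∈ S, Squarefree (Ideal.absNorm I) ∧
            Nat.Coprime (Ideal.absNorm I) (NumberField.discr K).natAbs ∧
            (Ideal.absNorm I : ℝ) ≤ |(NumberField.discr K : ℝ)| ^ ϖ) →
          (hTorsion K ℓ : ℝ) ≤
            C * |(NumberField.discr K : ℝ)| ^ (1 / 2 + ε : ℝ) * (M : ℝ)⁻¹ := by
  rcases Nat.lt_or_ge n 2 with hn | hn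
  · refine ⟨1, one_pos, fun K _ _ hK M hM S hSM hS => ?_⟩
    have h1 : Module.finrank ℚ K = 1 := by
      have := Module.finrank_pos (R := ℚ) (M := K)
      omega
    have hD := abs_discr_eq_one_of_finrank_eq_one h1
    -- the unit ideal is the only ideal of norm at most `1`
    have hM1 : M ≤ 1 := by
      rw [← hSM, Finset.card_le_one]
      have htop : ∀ I ∈ S, I = ⊤ := by
        intro I hI
        obtain ⟨h2, -, h3⟩ := hS I hI
        rw [hD, Real.one_rpow] at h3
        have h4 : Ideal.absNorm I ≤ 1 := by exact_mod_cast h3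
        exact Ideal.absNorm_eq_one_iff.mp
          (le_antisymm h4 (Nat.pos_of_ne_zero h2.ne_zero))
      exact fun I hI I' hI' => (htop I hI).trans (htop I' hI').symm
    obtain rfl : M = 1 := le_antisymm hM1 hM
    rw [hTorsion_eq_one_of_finrank_eq_one h1, hD, Real.one_rpow]
    norm_num
  · have hn1 : (1 : ℝ) ≤ (n : ℝ) - 1 := by
      have : (2 : ℝ) ≤ n := by exact_mod_cast hn
      linarith
    have hn0 : (0 : ℝ) < n := by linarith
    have hℓ0 : (0 : ℝ) < ℓ := by exact_mod_cast hℓ.pos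
    set κ : ℝ := 2 * ℓ * (n - 1) with hκ
    have hκ0 : 0 < κ := by positivity
    set ϖ' := max ϖ 0 with hϖ'
    have hϖ'0 : 0 ≤ ϖ' := le_max_right _ _
    set δ := 1 - κ * ϖ' with hδ
    have hδ0 : 0 < δ := by
      have h1 : ϖ' < 1 / κ :=
        max_lt (hϖ.resolve_left (by omega)) (by positivity)
      rw [lt_div_iff₀ hκ0] at h1
      linarith
    -- boxes of this side leave room `δ / 2` in the exponent of the discriminant bound
    set η := δ / (2 * κ * n) with hη
    have hη0 : 0 < η := by positivity
    -- the discriminant bound fails for `D > D₀`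
    set D₀ : ℝ := ((n.factorial : ℝ) ^ 2) ^ (2 / δ) with hD₀
    have hD₀0 : 0 ≤ D₀ := by positivity
    set s : ℝ := 1 + 2 * ε with hs
    have hs1 : 1 < s := by linarith
    set Z : ℝ := (∑' m : ℕ, 1 / (m : ℝ) ^ s) ^ n with hZ
    have hZ0 : 0 ≤ Z := pow_nonneg (tsum_nonneg fun m => by positivity) n
    set c₁ : ℝ := Z * 2 ^ s * ((⌊2 / η⌋₊ + 1 : ℕ) : ℝ) ^ n with hc₁
    have hc₁0 : 0 ≤ c₁ := by positivity
    set M₀ : ℝ := Z * (D₀ ^ ϖ') ^ s with hM₀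
    have hM₀0 : 0 ≤ M₀ := by positivity
    refine ⟨c₁ * (1 + M₀) + 1, by positivity, fun K _ _ hK M hM S hSM hS => ?_⟩
    set D := |(discr K : ℝ)| with hD
    have hD2 : 2 ≤ D := by
      have h1 : 2 < |discr K| := abs_discr_gt_two (by omega)
      rw [hD]
      exact_mod_cast h1.le
    have hD0 : 0 < D := by linarith
    have hDpow : (2 * √D) ^ s = 2 ^ s * D ^ (1 / 2 + ε) := by
      rw [Real.mul_rpow two_pos.le (Real.sqrt_nonneg D), Real.sqrt_eq_rpow, ← Real.rpow_mul hD0.le]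
      congr 2
      rw [hs]
      ring
    have hbound : ∀ S' : Finset (Ideal (𝓞 K)), S' ⊆ S →
        ((∀ I ∈ S', ∀ I' ∈ S', I = I') ∨ (n.factorial : ℝ) ^ 2 *
          ((D ^ η) ^ (ℓ * n) * (D ^ ϖ') ^ ℓ) ^ (2 * (n - 1)) < D) →
        (hTorsion K ℓ * S'.card : ℝ) ≤ c₁ * D ^ (1 / 2 + ε) := by
      intro S' hS' hsep
      have h1 := hTorsion_mul_card_le (K := K) hℓ.ne_zero hD2 hη0 (S := S') (Y := D ^ ϖ')
        (fun I hI => ⟨(hS I (hS' hI)).1, (hS I (hS' hI)).2.1, (hS I (hS' hI)).2.2.trans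
          (Real.rpow_le_rpow_of_exponent_le (by linarith) (le_max_left _ _))⟩)
        (by rw [hK]; exact hsep) hs1
      rw [hK, ← hD, hDpow] at h1
      refine h1.trans (le_of_eq ?_)
      rw [hc₁]
      ring
    have hM0 : (0 : ℝ) < M := by exact_mod_cast hM
    rw [← div_eq_mul_inv, le_div_iff₀ hM0]
    have hDε : 0 < D ^ (1 / 2 + ε) := Real.rpow_pos_of_pos hD0 _
    suffices h : (hTorsion K ℓ * M : ℝ) ≤ c₁ * D ^ (1 / 2 + ε) * (1 + M₀) by
      refine h.trans ?_
      rw [add_mul, one_mul]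
      nlinarith
    have hc : 0 ≤ c₁ * D ^ (1 / 2 + ε) := by positivity
    rcases lt_or_ge D₀ D with hlt | hge
    · have hsep : (n.factorial : ℝ) ^ 2 *
          ((D ^ η) ^ (ℓ * n) * (D ^ ϖ') ^ ℓ) ^ (2 * (n - 1)) < D := by
        have h1 : ((D ^ η) ^ (ℓ * n) * (D ^ ϖ') ^ ℓ) ^ (2 * (n - 1)) = D ^ (1 - δ / 2) := by
          rw [← Real.rpow_natCast (D ^ η), ← Real.rpow_mul hD0.le, ← Real.rpow_natCast (D ^ ϖ'),
            ← Real.rpow_mul hD0.le, ← Real.rpow_add hD0, ← Real.rpow_natCast,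
            ← Real.rpow_mul hD0.le]
          congr 1
          rw [Nat.cast_mul, Nat.cast_mul, Nat.cast_sub (by omega), Nat.cast_one, Nat.cast_ofNat]
          have h2 : κ * (η * n) = δ / 2 := by
            rw [hη]
            field_simp
          have h3 : κ * ϖ' = 1 - δ := by rw [hδ]; ring
          calc (η * (ℓ * n) + ϖ' * ℓ) * (2 * ((n : ℝ) - 1))
              = κ * (η * n) + κ * ϖ' := by rw [hκ]; ring
            _ = 1 - δ / 2 := by rw [h2, h3]; ring
        have h4 : (n.factorial : ℝ) ^ 2 < D ^ (δ / 2) := by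
          have h5 := Real.rpow_lt_rpow hD₀0 hlt (half_pos hδ0)
          rwa [hD₀, ← Real.rpow_mul (by positivity), div_mul_div_cancel₀' two_ne_zero,
            div_self hδ0.ne', Real.rpow_one] at h5
        rw [h1]
        calc _ < D ^ (δ / 2) * D ^ (1 - δ / 2) := by gcongr
          _ = D := by
            rw [← Real.rpow_add hD0, add_sub_cancel, Real.rpow_one]
      have h1 := hbound S subset_rfl (Or.inr hsep)
      rw [hSM] at h1
      exact h1.trans (le_mul_of_one_le_right hc (by linarith))
    · -- for bounded discriminant `M` is bounded, and a single ideal gives the bound for `h_ℓ`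
      have hMle : (M : ℝ) ≤ M₀ := by
        have h1 := card_le_of_absNorm_le hs1 (X := D₀ ^ ϖ') (by positivity) S (fun I hI => by
          obtain ⟨h1, -, h2⟩ := hS I hI
          refine ⟨?_, h2.trans ?_⟩
          · rintro rfl
            simpa using h1.ne_zero
          · exact (Real.rpow_le_rpow_of_exponent_le (by linarith) (le_max_left _ _)).trans
              (Real.rpow_le_rpow hD0.le hge hϖ'0))
        rwa [hK, hSM] at h1
      obtain ⟨I, hI⟩ := Finset.card_pos.mp (hSM ▸ hM)
      have h1 := hbound {I} (Finset.singleton_subset_iff.mpr hI) (Or.inl (by simp))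
      rw [Finset.card_singleton, Nat.cast_one, mul_one] at h1
      exact mul_le_mul h1 (hMle.trans (by linarith)) hM0.le hc
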